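/- Let $p$ be an odd prime, $\zeta$ a primitive $p$-th root of unity, $\lambda=\zeta-1$, and let $\pi=\lambda\mathbb Z[\zeta]$ be the prime of $\mathbb Q(\zeta)$ above $p$. For $x,y\in\mathbb Q(\zeta)$ and $n\ge 0$ write $x\equiv y \bmod \pi^n$ if $v_\pi(x-y)\ge n$. Let $u$ be a primitive root modulo $p$ and $\sigma$ the automorphism of $\mathbb Q(\zeta)$ with $\sigma(\zeta)=\zeta^u$; a bar denotes complex conjugation. Let $C_p^-$ be the group of the ideal classes $c$ of $\mathbb Q(\zeta)$ with $c^p=1$ and $\overline c=c^{-1}$. A number $C\in\mathbb Q(\zeta)^*$ is called singular if $C\,\mathbb Z[\zeta]=\mathfrak c^p$ for some fractional ideal $\mathfrak c$ of $\mathbb Q(\zeta)$. It is called singular primary if moreover $C\equiv c^p \bmod \pi^p$ for some $c\in\mathbb Z$ with $p\nmid c$. For $i=1,2$ let $\mathfrak b_i$ be a non-principal integral ideal of $\mathbb Z[\zeta]$, prime to $\pi$, with class $\mathrm{Cl}(\mathfrak b_i)\in C_p^-$ and $\sigma(\mathrm{Cl}(\mathfrak b_i))=\mathrm{Cl}(\mathfrak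 b_i)^{\mu_i}$, where $\mu_i\in\mathbb F_p^*$, $\mu_i\equiv u^{2m_i+1} \bmod p$ and $1\le m_i\le \frac{p-3}{2}$. Let $B_i\in\mathbb Z[\zeta]$ satisfy $B_i\mathbb Z[\zeta]=\mathfrak b_i^p$ and $$C_i=\frac{B_i}{\overline{B_i}}\equiv 1 \bmod \pi^{2m_i+1}.$$ Suppose that $C_i$ is normalized, that is, $C_i\equiv 1+\lambda^{\nu_i} \bmod \pi^{\nu_i+1}$ for some integer $\nu_i\ge 1$, and that $C_i$ is singular but not singular primary. If $\mu_1=\mu_2$, then $C_1C_2^{-1}$ is singular primary, and $C_1\equiv C_2 \bmod \pi^p$. -/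

import Mathlib

open NumberField IsDedekindDomain
open scoped nonZeroDivisors

namespace CyclotomicClass

noncomputable section

variable {p : ℕ} [hp : Fact p.Prime]
variable {K : Type*} [Field K] [NumberField K] [IsCyclotomicExtension {p} ℚ K] {ζ : K}

/-- The prime `π = (1 - ζ) ℤ[ζ]` of `ℚ(ζ)` above `p`. -/
def primePi (hζ : IsPrimitiveRoot ζ p) : HeightOneSpectrum (𝓞 K) where
  asIdeal := Ideal.span {hζ.toInteger - 1}
  isPrime := (Ideal.span_singleton_prime hζ.zeta_sub_one_prime'.ne_zero).2 hζ.zeta_sub_one_prime'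
  ne_bot := by
    simpa [Ideal.span_singleton_eq_bot] using hζ.zeta_sub_one_prime'.ne_zero

/-- `x ≡ y mod π ^ n` for elements of `ℚ(ζ)`: `v_π (x - y) ≥ n`. -/
def CongrModPi (hζ : IsPrimitiveRoot ζ p) (n : ℕ) (x y : K) : Prop :=
  (primePi hζ).valuation K (x - y) ≤ WithZero.exp (-(n : ℤ))

variable (p K) in
/-- Complex conjugation of `ℚ(ζ)`: the automorphism that raises the `p`-th roots of unity to the
power `-1`. -/
def conj : K ≃ₐ[ℚ] K := (IsCyclotomicExtension.Rat.galEquivZMod p K).symm (-1)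

theorem conj_zeta (hζ : IsPrimitiveRoot ζ p) : conj p K ζ = ζ⁻¹ := by
  have h := IsCyclotomicExtension.Rat.galEquivZMod_apply_of_pow_eq p K (conj p K) hζ.pow_eq_one
  rw [h, conj, MulEquiv.apply_symm_apply]
  have hz : ζ ≠ 0 := hζ.ne_zero hp.1.ne_zero
  refine eq_inv_of_mul_eq_one_left ?_
  rw [← pow_succ, hζ.pow_eq_one_iff_dvd, ← ZMod.natCast_eq_zero_iff]
  simp

/-- The action of an automorphism of the field `K` on its class group. -/
def galClass (τ : K ≃ₐ[ℚ] K) : ClassGroup (𝓞 K) ≃* ClassGroup (𝓞 K) :=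
  ClassGroup.mulEquiv (RingOfIntegers.mapRingEquiv τ.toRingEquiv)

theorem galClass_mk0 (τ : K ≃ₐ[ℚ] K) (I J : (Ideal (𝓞 K))⁰)
    (h : (J : Ideal (𝓞 K)) = (I : Ideal (𝓞 K)).map (RingOfIntegers.mapRingEquiv τ.toRingEquiv)) :
    galClass τ (ClassGroup.mk0 I) = ClassGroup.mk0 J := by
  simp only [galClass, ClassGroup.mulEquiv, MulEquiv.trans_apply]
  rw [ClassGroup.equiv_mk0, MulEquiv.symm_apply_eq, ClassGroup.equiv_mk0]
  change QuotientGroup.mk' _ _ = QuotientGroup.mk' _ _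
  congr 1
  ext1
  rw [FractionalIdeal.coe_mk0, h]
  set f := RingOfIntegers.mapRingEquiv τ.toRingEquiv with hf
  change FractionalIdeal.ringEquivOfRingEquiv _ _ f
    (Units.val (FractionalIdeal.mk0 (FractionRing (𝓞 K)) I)) = _
  rw [FractionalIdeal.coe_mk0]
  ext x
  rw [FractionalIdeal.mem_coeIdeal]
  change x ∈ Submodule.map _ _ ↔ _
  rw [Submodule.mem_map]
  constructor
  · rintro ⟨y, hy, rfl⟩
    obtain ⟨a, ha, rfl⟩ := (FractionalIdeal.mem_coeIdeal _).1 hy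
    exact ⟨f a, Ideal.mem_map_of_mem _ ha,
      (IsFractionRing.ringEquivOfRingEquiv_algebraMap f a).symm⟩
  · rintro ⟨b, hb, rfl⟩
    obtain ⟨a, ha, rfl⟩ := (Ideal.mem_map_of_equiv f b).1 hb
    exact ⟨algebraMap _ _ a, FractionalIdeal.mem_coeIdeal_of_mem _ ha,
      IsFractionRing.ringEquivOfRingEquiv_algebraMap f a⟩

variable (p K) in
/-- The relative part `C_p⁻` of the group of the ideal classes `c` with `c ^ p = 1`: those on
which complex conjugation acts as inversion. -/
def relClassGroup : Subgroup (ClassGroup (𝓞 K)) where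
  carrier := {c | c ^ p = 1 ∧ galClass (conj p K) c = c⁻¹}
  one_mem' := by simp
  mul_mem' := by
    rintro a b ⟨ha, ha'⟩ ⟨hb, hb'⟩
    exact ⟨by rw [mul_pow, ha, hb, one_mul], by rw [map_mul, ha', hb', mul_inv]⟩
  inv_mem' := by
    rintro a ⟨ha, ha'⟩
    exact ⟨by rw [inv_pow, ha, inv_one], by rw [map_inv, ha']⟩

variable (p) in
/-- A number `C` of `ℚ(ζ)`, `C ≠ 0`, is singular if `C ℤ[ζ]` is the `p`-th power of a fractional
ideal. -/
def IsSingular (C : K) : Prop :=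
  C ≠ 0 ∧ ∃ c : FractionalIdeal (𝓞 K)⁰ K, FractionalIdeal.spanSingleton (𝓞 K)⁰ C = c ^ p

/-- `C` is singular primary if it is singular and `C ≡ c ^ p mod π ^ p` for a rational integer `c`
prime to `p`. -/
def IsSingularPrimary (hζ : IsPrimitiveRoot ζ p) (C : K) : Prop :=
  IsSingular p C ∧ ∃ c : ℤ, ¬ (p : ℤ) ∣ c ∧ CongrModPi hζ p C ((c : K) ^ p)

/-- `C` is singular, but not singular primary. -/
def IsSingularNotPrimary (hζ : IsPrimitiveRoot ζ p) (C : K) : Prop :=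
  IsSingular p C ∧ ¬ IsSingularPrimary hζ C

/-- `C = B / conj B` is a number attached to the ideal `𝔟`, whose class is an eigenvector of `σ`
in `C_p⁻` with eigenvalue `μ = u ^ (2 m + 1)`. -/
structure IsAttached (hζ : IsPrimitiveRoot ζ p) (u : ℕ) (σ : K ≃ₐ[ℚ] K)
    (𝔟 : (Ideal (𝓞 K))⁰) (μ : (ZMod p)ˣ) (m : ℕ) (B : 𝓞 K) (C : K) : Prop where
  coprime : (𝔟 : Ideal (𝓞 K)) ⊔ (primePi hζ).asIdeal = ⊤
  not_principal : ClassGroup.mk0 𝔟 ≠ 1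
  mem_relClassGroup : ClassGroup.mk0 𝔟 ∈ relClassGroup p K
  eigen : galClass σ (ClassGroup.mk0 𝔟) = ClassGroup.mk0 𝔟 ^ (μ : ZMod p).val
  one_le : 1 ≤ m
  le : 2 * m + 3 ≤ p
  eigenvalue : (μ : ZMod p) = (u : ZMod p) ^ (2 * m + 1)
  span_eq : Ideal.span {B} = (𝔟 : Ideal (𝓞 K)) ^ p
  eq_div : C = (B : K) / conj p K (B : K)
  congr_one : CongrModPi hζ (2 * m + 1) C 1

/-- The leading coefficient of the `λ`-adic expansion of `C - 1`, where `λ = ζ - 1`, is `1`. -/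
def IsNormalized (hζ : IsPrimitiveRoot ζ p) (C : K) : Prop :=
  ∃ ν : ℕ, 1 ≤ ν ∧ CongrModPi hζ (ν + 1) C (1 + (ζ - 1) ^ ν)

end

end CyclotomicClass

/-!
The class of `𝔟` being an eigenvector of `σ` with eigenvalue `μ`, the ideals `σ 𝔟` and `𝔟 ^ μ`
differ by a principal ideal, so that `σ B = α ^ p * B ^ μ * ε` with a unit `ε`. As `σ` commutes
with complex conjugation and `ε / conj ε` is, up to sign, a power of `ζ` (Kronecker), this yields
`σ C = C ^ μ * a ^ p * ζ ^ k` (`IsAttached.exists_map_eq`). Since `C ≡ 1 mod π ^ 3`, the root of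
unity is `1` and `a ≡ 1 mod π`, whence `a ^ p ≡ 1 mod π ^ p`; hence `σ C ≡ C ^ μ mod π ^ p`
(`IsAttached.exists_localRing`).

On the other hand `σ λ ≡ u λ mod λ ^ 2`, where `λ = ζ - 1`. If `D ≡ 1 + z λ ^ n mod π ^ (n + 1)`
with an integer `z` and `n < p`, and `σ D ≡ D ^ μ mod π ^ p`, then comparing the coefficients of
`λ ^ n` gives `u ^ n z ≡ μ z mod p`. So the coefficient `z` vanishes unless `u ^ n ≡ μ`
(`pow_succ_dvd_sub_one`).

Applied to `D = C`, this shows that `C - 1` has leading term `λ ^ (2 m + 1)`, where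
`μ = u ^ (2 m + 1)` (`IsAttached.congr_one_add_lam_pow`). If `μ₁ = μ₂`, then the leading terms of `C₁ - 1` and
`C₂ - 1` agree, so `D = C₁ / C₂` is congruent to `1` modulo `π ^ (2 m + 2)`. The exponents `n`
with `2 m + 2 ≤ n < p` satisfy `u ^ n ≠ μ`, and applying the principle to `D` at each of them
gives `D ≡ 1 mod π ^ p`.

The congruences are handled as divisibilities in the valuation ring of `π`, to which `σ`
restricts.
-/

namespace CyclotomicClass

/-! ### Congruences in an abstract local ring

Here `V` is a ring with an element `l` such that `V / l` is the prime field of `p` elements, in the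
sense that every element is congruent to an integer and `l` divides an integer exactly when `p`
does. It stands for the local ring at `π`, with `l = ζ - 1`. -/

section LocalRing

variable {p : ℕ} {V : Type*} [CommRing V] {l : V}

theorem mk_span_eq_mk_iff {x y z : V} :
    Ideal.Quotient.mk (Ideal.span {z}) x = Ideal.Quotient.mk (Ideal.span {z}) y ↔ z ∣ x - y := by
  rw [Ideal.Quotient.eq, Ideal.mem_span_singleton]

theorem pow_dvd_pow_sub_one [hp : Fact p.Prime] (hlp : l ^ (p - 1) ∣ (p : V)) {a : V}
    (ha : l ∣ a - 1) : l ^ p ∣ a ^ p - 1 := by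
  obtain ⟨t, ht⟩ := ha
  obtain ⟨r, hr⟩ := exists_add_pow_prime_eq hp.1 1 (l * t)
  obtain rfl : a = 1 + l * t := by rw [← ht]; ring
  obtain ⟨s, hs⟩ := hlp
  have hl : l ^ (p - 1) * l = l ^ p := pow_sub_one_mul hp.1.ne_zero l
  rw [hr, hs, one_pow, add_sub_right_comm, add_sub_cancel_left]
  exact dvd_add ⟨t ^ p, mul_pow _ _ _⟩ ⟨s * t * r, by rw [← hl]; ring⟩

theorem dvd_sub_one_of_dvd_pow_sub_one [hp : Fact p.Prime]
    (hres : ∀ a : V, ∃ z : ℤ, l ∣ a - z) (hint : ∀ z : ℤ, l ∣ (z : V) ↔ (p : ℤ) ∣ z) {a : V}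
    (ha : l ∣ a ^ p - 1) : l ∣ a - 1 := by
  obtain ⟨z, hz⟩ := hres a
  have h1 : l ∣ ((z ^ p - 1 : ℤ) : V) := by
    have := dvd_sub ha (hz.trans (sub_dvd_pow_sub_pow a (z : V) p))
    push_cast
    convert this using 1
    ring
  rw [hint, ← ZMod.intCast_zmod_eq_zero_iff_dvd] at h1
  push_cast at h1
  rw [ZMod.pow_card] at h1
  have h2 : l ∣ ((z - 1 : ℤ) : V) := by
    rw [hint, ← ZMod.intCast_zmod_eq_zero_iff_dvd]
    simpa using h1
  have := dvd_add hz h2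
  push_cast at this
  convert this using 1
  ring

/-- If `C` and `C'` are congruent to `1` modulo `l ^ 3` and `C' = C ^ m * a ^ p * (1 + l) ^ k`, then
the factor `a ^ p` is `1` modulo `l ^ p` and the root of unity `(1 + l) ^ k` is equal to `1`. -/
theorem pow_dvd_sub_of_eq_mul [IsDomain V] [hp : Fact p.Prime] (hp2 : 3 ≤ p) (hl : l ≠ 0)
    (hres : ∀ a : V, ∃ z : ℤ, l ∣ a - z) (hint : ∀ z : ℤ, l ∣ (z : V) ↔ (p : ℤ) ∣ z)
    (hlp : l ^ (p - 1) ∣ (p : V)) (hζ : (1 + l) ^ p = 1)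
    {C C' a : V} {m k : ℕ} (hC : l ^ 3 ∣ C - 1) (hC' : l ^ 3 ∣ C' - 1)
    (h : C' = C ^ m * a ^ p * (1 + l) ^ k) : l ^ p ∣ C' - C ^ m := by
  have ha : l ∣ a - 1 := by
    apply dvd_sub_one_of_dvd_pow_sub_one hres hint
    have h1 := mk_span_eq_mk_iff.2 ((dvd_pow_self l three_ne_zero).trans hC)
    have h2 := mk_span_eq_mk_iff.2 ((dvd_pow_self l three_ne_zero).trans hC')
    have h3 : Ideal.Quotient.mk (Ideal.span {l}) (1 + l) = Ideal.Quotient.mk (Ideal.span {l}) 1 :=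
      mk_span_eq_mk_iff.2 (by simp)
    rw [← mk_span_eq_mk_iff]
    rw [h, map_mul, map_mul, map_pow, map_pow _ (1 + l), h1, h3] at h2
    simpa using h2
  have hap := pow_dvd_pow_sub_one hlp ha
  have hk : (1 + l) ^ k = 1 := by
    have h3 : l ^ 3 ∣ (1 + l) ^ k - 1 := by
      have h1 := mk_span_eq_mk_iff.2 hC
      have h2 := mk_span_eq_mk_iff.2 hC'
      have h3 := mk_span_eq_mk_iff.2 ((pow_dvd_pow l hp2).trans hap)
      rw [← mk_span_eq_mk_iff]
      rw [h, map_mul, map_mul, map_pow, h1, h3] at h2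
      simpa using h2
    -- Since `(1 + l) ^ k = 1 + k * l` modulo `l ^ 2`, the exponent `k` is divisible by `p`.
    have h2 : l * l ∣ l * ((k : ℤ) : V) := by
      have h := dvd_sub ((pow_dvd_pow l (Nat.le_succ 2)).trans h3) (sq_dvd_add_pow_sub_sub l 1 k)
      rw [← sq]
      convert! h using 1
      push_cast
      ring
    rw [mul_dvd_mul_iff_left hl, hint, Int.natCast_dvd_natCast] at h2
    obtain ⟨j, rfl⟩ := h2
    rw [pow_mul, hζ, one_pow]
  rw [h, hk, mul_one, ← mul_sub_one]
  exact hap.mul_left _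

/-- Let `s` be an endomorphism that multiplies `l` by `u` to first order. If `D = 1 + z * l ^ n` to
first order, then so are `s D = 1 + u ^ n * z * l ^ n` and `D ^ m = 1 + m * z * l ^ n`; when these
agree and `u ^ n ≠ m` in the residue field, the coefficient `z` vanishes. -/
theorem pow_succ_dvd_sub_one [IsDomain V] [hp : Fact p.Prime] (hl : l ≠ 0)
    (hres : ∀ a : V, ∃ z : ℤ, l ∣ a - z) (hint : ∀ z : ℤ, l ∣ (z : V) ↔ (p : ℤ) ∣ z)
    {s : V →+* V} {u : ℕ} (hs : l ^ 2 ∣ s l - u * l) {n m : ℕ} (hn : 1 ≤ n)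
    (hne : (u : ZMod p) ^ n ≠ m) {D : V} (hD : l ^ n ∣ D - 1)
    (hsD : l ^ (n + 1) ∣ s D - D ^ m) : l ^ (n + 1) ∣ D - 1 := by
  obtain ⟨y, hy⟩ := hD
  obtain ⟨z, w, hw⟩ := hres y
  obtain ⟨x, hx⟩ := hs
  obtain rfl : D = 1 + l ^ n * y := by rw [← hy]; ring
  have hsl : s l = l * (u + l * x) := by linear_combination hx
  have hsy : s y = z + s l * s w := by
    have := congrArg s hw
    rw [map_sub, map_intCast, map_mul] at this
    linear_combination this
  -- Both `s D` and `D ^ m` have an explicit first-order expansion modulo `l ^ (n + 1)`.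
  have h1 : l ^ (n + 1) ∣ s (1 + l ^ n * y) - (1 + l ^ n * (u ^ n * z)) := by
    have hu : l ∣ (u + l * x) ^ n - (u : V) ^ n :=
      (Dvd.intro x (by ring)).trans (sub_dvd_pow_sub_pow (u + l * x) (u : V) n)
    obtain ⟨t, ht⟩ := hu
    rw [map_add, map_one, map_mul, map_pow, hsy, hsl, mul_pow, eq_add_of_sub_eq ht]
    exact ⟨t * z + (l * t + u ^ n) * (u + l * x) * s w, by ring⟩
  have h2 : l ^ (n + 1) ∣ (1 + l ^ n * y) ^ m - (1 + l ^ n * (m * z)) := by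
    have h := sq_dvd_add_pow_sub_sub (l ^ n * y) 1 m
    have h' : l ^ (n + 1) ∣ (l ^ n * y) ^ 2 := by
      rw [mul_pow, ← pow_mul]
      exact (pow_dvd_pow l (by lia)).mul_right _
    have h'' : l ^ (n + 1) ∣ l ^ n * (m * (y - z)) := ⟨m * w, by rw [hw]; ring⟩
    convert dvd_add (h'.trans h) h'' using 1
    ring
  have h3 : l ^ n * l ∣ l ^ n * (((u ^ n - m) * z : ℤ) : V) := by
    rw [← pow_succ]
    convert dvd_add (dvd_sub hsD h1) h2 using 1
    push_cast
    ring
  rw [mul_dvd_mul_iff_left (pow_ne_zero n hl), hint, (Nat.prime_iff_prime_int.1 hp.1).dvd_mul] at h3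
  have h4 : ¬ (p : ℤ) ∣ u ^ n - m := by
    rw [← ZMod.intCast_zmod_eq_zero_iff_dvd]
    push_cast
    rwa [sub_eq_zero]
  obtain ⟨t, ht⟩ := (hint z).2 (h3.resolve_left h4)
  exact ⟨t + w, by linear_combination l ^ n * hw + l ^ n * ht⟩

end LocalRing
/-! ### The local ring of `ℚ(ζ)` at `π` -/

noncomputable section LocalRingAtPi

variable {p : ℕ} [hp : Fact p.Prime]
variable {K : Type*} [Field K] [NumberField K] [IsCyclotomicExtension {p} ℚ K] {ζ : K}

/-- The local ring of `ℚ(ζ)` at `π`, as a valuation subring. -/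
def localRing (hζ : IsPrimitiveRoot ζ p) : ValuationSubring K :=
  ((primePi hζ).valuation K).valuationSubring

theorem mem_localRing (hζ : IsPrimitiveRoot ζ p) {x : K} :
    x ∈ localRing hζ ↔ (primePi hζ).valuation K x ≤ 1 := Iff.rfl

theorem coe_mem_localRing (hζ : IsPrimitiveRoot ζ p) (x : 𝓞 K) : (x : K) ∈ localRing hζ :=
  (primePi hζ).valuation_le_one x

theorem valuation_zeta_sub_one (hζ : IsPrimitiveRoot ζ p) :
    (primePi hζ).valuation K (ζ - 1) = WithZero.exp (-1) := by
  have h := (primePi hζ).intValuation_singleton hζ.zeta_sub_one_prime'.ne_zero rfl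
  rw [← (primePi hζ).valuation_of_algebraMap (K := K)] at h
  exact h

/-- The uniformizer `λ = ζ - 1` of the local ring at `π`. -/
def lam (hζ : IsPrimitiveRoot ζ p) : localRing hζ :=
  ⟨ζ - 1, coe_mem_localRing hζ (hζ.toInteger - 1)⟩

theorem coe_lam (hζ : IsPrimitiveRoot ζ p) : (lam hζ : K) = ζ - 1 := rfl

omit [NumberField K] [IsCyclotomicExtension {p} ℚ K] in
theorem zeta_sub_one_ne_zero (hζ : IsPrimitiveRoot ζ p) : ζ - 1 ≠ 0 :=
  sub_ne_zero.2 (hζ.ne_one hp.1.one_lt)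

theorem lam_ne_zero (hζ : IsPrimitiveRoot ζ p) : lam hζ ≠ 0 :=
  fun h ↦ zeta_sub_one_ne_zero hζ (congrArg Subtype.val h)

theorem one_add_lam_pow (hζ : IsPrimitiveRoot ζ p) : (1 + lam hζ) ^ p = 1 := by
  apply Subtype.ext
  simp [coe_lam, hζ.pow_eq_one]

theorem valuation_zeta_sub_one_pow (hζ : IsPrimitiveRoot ζ p) (n : ℕ) :
    (primePi hζ).valuation K ((ζ - 1) ^ n) = WithZero.exp (-(n : ℤ)) := by
  rw [map_pow, valuation_zeta_sub_one, ← WithZero.exp_nsmul]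
  simp

theorem valuation_le_exp_iff (hζ : IsPrimitiveRoot ζ p) (n : ℕ) (x : K) :
    (primePi hζ).valuation K x ≤ WithZero.exp (-(n : ℤ)) ↔
      ∃ t : localRing hζ, x = (ζ - 1) ^ n * t := by
  have hne : (ζ - 1) ^ n ≠ 0 := pow_ne_zero n (zeta_sub_one_ne_zero hζ)
  have hpos := (Valuation.pos_iff ((primePi hζ).valuation K)).2 hne
  have hx : x = (ζ - 1) ^ n * (x / (ζ - 1) ^ n) := (mul_div_cancel₀ x hne).symm
  rw [← valuation_zeta_sub_one_pow hζ]
  constructor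
  · intro h
    refine ⟨⟨x / (ζ - 1) ^ n, ?_⟩, hx⟩
    rw [mem_localRing, map_div₀]
    exact div_le_one_of_le₀ h zero_le
  · rintro ⟨t, rfl⟩
    rw [map_mul]
    exact mul_le_of_le_one_right' t.2

theorem lam_pow_dvd_iff (hζ : IsPrimitiveRoot ζ p) (n : ℕ) (a : localRing hζ) :
    lam hζ ^ n ∣ a ↔ (primePi hζ).valuation K (a : K) ≤ WithZero.exp (-(n : ℤ)) := by
  rw [valuation_le_exp_iff]
  exact exists_congr fun t ↦ Subtype.ext_iff

theorem congrModPi_iff (hζ : IsPrimitiveRoot ζ p) (n : ℕ) (a b : localRing hζ) :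
    CongrModPi hζ n (a : K) b ↔ lam hζ ^ n ∣ a - b := by
  rw [lam_pow_dvd_iff]
  rfl

theorem CongrModPi.mem_localRing {hζ : IsPrimitiveRoot ζ p} {n : ℕ} {x y : K}
    (h : CongrModPi hζ n x y) (hy : y ∈ localRing hζ) : x ∈ localRing hζ := by
  obtain ⟨t, ht⟩ := (valuation_le_exp_iff hζ n _).1 h
  obtain rfl : x = ((lam hζ ^ n * t + ⟨y, hy⟩ : localRing hζ) : K) := by
    push_cast
    rw [coe_lam, ← ht, sub_add_cancel]
  exact Subtype.property _

theorem lam_pow_dvd_coe (hζ : IsPrimitiveRoot ζ p) (n : ℕ) {a : 𝓞 K}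
    (h : (hζ.toInteger - 1) ^ n ∣ a) :
    lam hζ ^ n ∣ (⟨a, coe_mem_localRing hζ a⟩ : localRing hζ) := by
  obtain ⟨b, rfl⟩ := h
  refine ⟨⟨b, coe_mem_localRing hζ b⟩, Subtype.ext ?_⟩
  push_cast
  rfl

theorem lam_dvd_coe_iff (hζ : IsPrimitiveRoot ζ p) {a : 𝓞 K} :
    lam hζ ∣ (⟨a, coe_mem_localRing hζ a⟩ : localRing hζ) ↔ hζ.toInteger - 1 ∣ a := by
  constructor
  · intro h
    rw [← pow_one (lam hζ), lam_pow_dvd_iff] at h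
    change (primePi hζ).valuation K (algebraMap (𝓞 K) K a) ≤ _ at h
    rw [HeightOneSpectrum.valuation_of_algebraMap, HeightOneSpectrum.intValuation_le_pow_iff_mem,
      pow_one] at h
    exact Ideal.mem_span_singleton.1 h
  · intro h
    simpa using lam_pow_dvd_coe hζ 1 (a := a) (by simpa using h)

theorem lam_dvd_intCast_iff (hζ : IsPrimitiveRoot ζ p) (z : ℤ) :
    lam hζ ∣ (z : localRing hζ) ↔ (p : ℤ) ∣ z := by
  rw [← IsCyclotomicExtension.Rat.zeta_sub_one_dvd_intCast_iff' p hζ, ← lam_dvd_coe_iff]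
  exact iff_of_eq (congrArg _ (Subtype.ext (by simp)))

theorem lam_pow_dvd_prime (hζ : IsPrimitiveRoot ζ p) :
    lam hζ ^ (p - 1) ∣ (p : localRing hζ) := by
  convert lam_pow_dvd_coe hζ (p - 1)
    (IsCyclotomicExtension.Rat.associated_zeta_sub_one_pow_prime p hζ).dvd using 1
  exact Subtype.ext (by simp)

theorem exists_int_zeta_sub_one_dvd_sub (hζ : IsPrimitiveRoot ζ p) (a : 𝓞 K) :
    ∃ z : ℤ, hζ.toInteger - 1 ∣ a - z := by
  obtain ⟨f, rfl⟩ := hζ.subOneIntegralPowerBasis.exists_eq_aeval' a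
  refine ⟨f.coeff 0, ?_⟩
  have h := map_dvd (Polynomial.aeval hζ.subOneIntegralPowerBasis.gen)
    (Polynomial.X_dvd_sub_C (p := f))
  simp only [Polynomial.aeval_X, map_sub, Polynomial.aeval_C] at h
  rw [hζ.subOneIntegralPowerBasis_gen] at h
  change hζ.toInteger - 1 ∣ _ at h
  simpa using h

/-- The residue field of `π` is the prime field: an element of the local ring is a quotient of two
algebraic integers with denominator prime to `π`. -/
theorem exists_int_lam_dvd_sub (hζ : IsPrimitiveRoot ζ p) (a : localRing hζ) :
    ∃ z : ℤ, lam hζ ∣ a - z := by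
  obtain ⟨b, hb⟩ := (primePi hζ).exists_valuation_sub_lt_of_integer a.2
    (Units.mk0 (WithZero.exp (-1)) WithZero.exp_ne_zero)
  obtain ⟨z, hz⟩ := exists_int_zeta_sub_one_dvd_sub hζ b
  have h1 : lam hζ ∣ a - ⟨b, coe_mem_localRing hζ b⟩ := by
    rw [← pow_one (lam hζ), lam_pow_dvd_iff]
    simpa [Valuation.map_sub_swap] using hb.le
  have h2 := (lam_dvd_coe_iff hζ).2 hz
  refine ⟨z, ?_⟩
  convert dvd_add h1 h2 using 1
  exact Subtype.ext (by simp)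

/-- Every automorphism of `ℚ(ζ)` preserves the local ring at `π`. -/
theorem map_mem_localRing (hζ : IsPrimitiveRoot ζ p) (σ : K ≃ₐ[ℚ] K) {x : K}
    (hx : x ∈ localRing hζ) : σ x ∈ localRing hζ := by
  obtain ⟨n, d, h⟩ := (primePi hζ).exists_primeCompl_mul_eq_of_integer x hx
  obtain ⟨z, hz⟩ := exists_int_zeta_sub_one_dvd_sub hζ d.1
  set f := RingOfIntegers.mapRingEquiv σ.toRingEquiv
  have hfc : ∀ y : 𝓞 K, ((f y : 𝓞 K) : K) = σ y := fun _ ↦ rfl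
  have hd : ¬ hζ.toInteger - 1 ∣ d.1 := fun h ↦ d.2 (Ideal.mem_span_singleton.2 h)
  have hlam : hζ.toInteger - 1 ∣ f (hζ.toInteger - 1) := by
    obtain ⟨j, hj⟩ : ∃ j : ℕ, σ ζ = ζ ^ j :=
      ⟨_, IsCyclotomicExtension.Rat.galEquivZMod_apply_of_pow_eq p K σ hζ.pow_eq_one⟩
    have : f (hζ.toInteger - 1) = hζ.toInteger ^ j - 1 ^ j := by
      apply RingOfIntegers.ext
      rw [hfc]
      simp only [map_sub, map_one, one_pow, map_pow]
      change σ ζ - 1 = ζ ^ j - 1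
      rw [hj]
    rw [this]
    exact sub_dvd_pow_sub_pow _ _ _
  have hfd : ¬ hζ.toInteger - 1 ∣ f d.1 := by
    intro h1
    have h2 := hlam.trans (map_dvd f hz)
    rw [map_sub, map_intCast, dvd_sub_right h1] at h2
    exact hd ((dvd_iff_dvd_of_dvd_sub hz).2 h2)
  have h3 := congrArg σ h
  rw [map_mul] at h3
  have h4 : (primePi hζ).valuation K (σ (d.1 : K)) = 1 := by
    rw [← hfc]
    exact HeightOneSpectrum.valuation_eq_one_iff_notMem _ |>.2
      fun h ↦ hfd (Ideal.mem_span_singleton.1 h)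
  rw [mem_localRing]
  have h5 : (primePi hζ).valuation K (σ x * σ (d.1 : K)) ≤ 1 := by
    rw [h3]
    exact coe_mem_localRing hζ (f n)
  rwa [map_mul, h4, mul_one] at h5

/-- The endomorphism of the local ring at `π` induced by an automorphism of `ℚ(ζ)`. -/
def localMap (hζ : IsPrimitiveRoot ζ p) (σ : K ≃ₐ[ℚ] K) : localRing hζ →+* localRing hζ :=
  (σ : K →+* K).restrict (localRing hζ) (localRing hζ) fun _ hx ↦ map_mem_localRing hζ σ hx

theorem coe_localMap (hζ : IsPrimitiveRoot ζ p) (σ : K ≃ₐ[ℚ] K) (a : localRing hζ) :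
    (localMap hζ σ a : K) = σ a := rfl

theorem lam_sq_dvd_localMap_lam_sub (hζ : IsPrimitiveRoot ζ p) {σ : K ≃ₐ[ℚ] K} {u : ℕ}
    (hσ : σ ζ = ζ ^ u) : lam hζ ^ 2 ∣ localMap hζ σ (lam hζ) - u * lam hζ := by
  convert! sq_dvd_add_pow_sub_sub (lam hζ) 1 u using 1
  apply Subtype.ext
  push_cast
  rw [coe_lam, coe_localMap, coe_lam, map_sub, map_one, hσ]
  ring

end LocalRingAtPi
/-! ### Complex conjugation and units -/

section Conj

variable {p : ℕ} [hp : Fact p.Prime]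
variable {K : Type*} [Field K] [NumberField K] [IsCyclotomicExtension {p} ℚ K] {ζ : K}

/-- `conj` induces complex conjugation under every embedding in `ℂ`. -/
theorem embedding_conj (hζ : IsPrimitiveRoot ζ p) (φ : K →+* ℂ) (x : K) :
    φ (conj p K x) = starRingEnd ℂ (φ x) := by
  have h : φ.toRatAlgHom.comp (conj p K).toAlgHom =
      ((starRingEnd ℂ).comp φ).toRatAlgHom := by
    refine (hζ.powerBasis ℚ).algHom_ext ?_
    rw [IsPrimitiveRoot.powerBasis_gen ℚ hζ]
    have h1 : ‖φ ζ‖ = 1 :=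
      Complex.norm_eq_one_of_pow_eq_one (by rw [← map_pow, hζ.pow_eq_one, map_one]) hp.1.ne_zero
    simpa [conj_zeta hζ, map_inv₀] using Complex.inv_eq_conj h1
  exact DFunLike.congr_fun h x

theorem conj_comm (σ : K ≃ₐ[ℚ] K) (x : K) : σ (conj p K x) = conj p K (σ x) := by
  have h : σ * conj p K = conj p K * σ := by
    apply (IsCyclotomicExtension.Rat.galEquivZMod p K).injective
    rw [map_mul, map_mul, mul_comm]
  exact DFunLike.congr_fun h x

/-- For a unit `ε` the quotient `ε / conj ε` has absolute value `1` at every embedding, so it is a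
root of unity by Kronecker's theorem. The sign is absorbed into the `p`-th power. -/
theorem exists_unit_div_conj_eq (hp2 : p ≠ 2) (hζ : IsPrimitiveRoot ζ p) (ε : (𝓞 K)ˣ) :
    ∃ (s : K) (k : ℕ), ((ε : 𝓞 K) : K) / conj p K ((ε : 𝓞 K) : K) = s ^ p * ζ ^ k := by
  have hodd : Odd p := hp.1.odd_of_ne_two hp2
  have hint : IsIntegral ℤ (((ε : 𝓞 K) : K) / conj p K ((ε : 𝓞 K) : K)) := by
    have h : (((ε⁻¹ : (𝓞 K)ˣ) : 𝓞 K) : K) = ((ε : 𝓞 K) : K)⁻¹ := by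
      apply eq_inv_of_mul_eq_one_left
      rw [← map_mul, Units.inv_mul, map_one]
    rw [div_eq_mul_inv, ← map_inv₀, ← h]
    exact (RingOfIntegers.isIntegral_coe _).mul ((RingOfIntegers.isIntegral_coe _).map (conj p K))
  obtain ⟨n, hn, h1⟩ := Embeddings.pow_eq_one_of_norm_eq_one K ℂ hint fun φ ↦ by
    rw [map_div₀, embedding_conj hζ, norm_div, RCLike.norm_conj, div_self]
    simp
  obtain ⟨r, hr⟩ := hζ.exists_neg_pow_of_isOfFinOrder hodd
    (isOfFinOrder_iff_pow_eq_one.2 ⟨n, hn, h1⟩)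
  refine ⟨(-1) ^ r, r, ?_⟩
  rw [hr, neg_pow ζ, ← pow_mul, mul_comm r p, pow_mul, hodd.neg_one_pow]

end Conj

/-! ### The action of the Galois group on `C` -/

section Attached

variable {p : ℕ} [hp : Fact p.Prime]
variable {K : Type*} [Field K] [NumberField K] [IsCyclotomicExtension {p} ℚ K] {ζ : K}
variable {hζ : IsPrimitiveRoot ζ p} {u : ℕ} {σ : K ≃ₐ[ℚ] K} {𝔟 : (Ideal (𝓞 K))⁰}
  {μ : (ZMod p)ˣ} {m : ℕ} {B : 𝓞 K} {C : K}

/-- The relation `σ(Cl 𝔟) = Cl(𝔟) ^ μ` gives `σ B = α ^ p * B ^ μ * ε` with `ε` a unit; dividing by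
the complex conjugate turns `ε` into a root of unity. -/
theorem IsAttached.exists_map_eq (hp2 : p ≠ 2) (h : IsAttached hζ u σ 𝔟 μ m B C) :
    ∃ (a : K) (k : ℕ), σ C = C ^ (μ : ZMod p).val * a ^ p * ζ ^ k := by
  set e := (μ : ZMod p).val
  set f := RingOfIntegers.mapRingEquiv σ.toRingEquiv
  have hfc : ∀ y : 𝓞 K, ((f y : 𝓞 K) : K) = σ y := fun _ ↦ rfl
  have hne : (𝔟 : Ideal (𝓞 K)).map f ≠ ⊥ := by
    rw [Ne, Ideal.map_eq_bot_iff_of_injective f.injective]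
    exact nonZeroDivisors.ne_zero 𝔟.2
  have hcl := h.eigen
  rw [galClass_mk0 σ 𝔟 ⟨_, mem_nonZeroDivisors_of_ne_zero hne⟩ rfl, ← map_pow,
    ClassGroup.mk0_eq_mk0_iff] at hcl
  obtain ⟨x, y, hx, hy, hxy⟩ := hcl
  have hspan : Ideal.span {x ^ p * f B} = Ideal.span {y ^ p * B ^ e} := by
    have h1 := congrArg (· ^ p) hxy
    simp only [mul_pow, SubmonoidClass.coe_pow] at h1
    rw [← pow_mul, mul_comm e p, pow_mul, ← h.span_eq] at h1
    have h2 : ((𝔟 : Ideal (𝓞 K)).map f) ^ p = Ideal.span {f B} := by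
      rw [← Ideal.map_pow, ← h.span_eq, Ideal.map_span, Set.image_singleton]
    rw [h2] at h1
    simpa only [Ideal.span_singleton_pow, Ideal.span_singleton_mul_span_singleton] using h1
  obtain ⟨ε, hε⟩ := (Ideal.span_singleton_eq_span_singleton.1 hspan).symm
  obtain ⟨s, k, hs⟩ := exists_unit_div_conj_eq hp2 hζ ε
  have hxK : (x : K) ≠ 0 := by simpa using hx
  have hσB : σ (B : K) = ((y : K) / x) ^ p * (B : K) ^ e * ((ε : 𝓞 K) : K) := by
    have := congrArg (algebraMap (𝓞 K) K) hε
    simp only [map_mul, map_pow, hfc] at this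
    rw [div_pow, div_mul_eq_mul_div, div_mul_eq_mul_div, eq_div_iff (pow_ne_zero p hxK)]
    exact (mul_comm _ _).trans this.symm
  refine ⟨(y : K) / x / conj p K ((y : K) / x) * s, k, ?_⟩
  rw [h.eq_div, map_div₀, conj_comm, hσB, map_mul (conj p K), map_mul (conj p K), map_pow,
    map_pow (conj p K) (B : K), mul_div_mul_comm, hs, mul_div_mul_comm, ← div_pow, ← div_pow]
  ring

end Attached
/-! ### The exponent of the leading term of `C - 1` -/

section Main

variable {p : ℕ} [hp : Fact p.Prime]
variable {K : Type*} [Field K] [NumberField K] [IsCyclotomicExtension {p} ℚ K] {ζ : K}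
variable {hζ : IsPrimitiveRoot ζ p} {u : ℕ} {σ : K ≃ₐ[ℚ] K} {𝔟 : (Ideal (𝓞 K))⁰}
  {μ : (ZMod p)ˣ} {m : ℕ} {B : 𝓞 K} {C : K}

theorem valuation_eq_one_of_lam_dvd_sub_one (c : localRing hζ) (h : lam hζ ∣ c - 1) :
    (primePi hζ).valuation K (c : K) = 1 := by
  rw [← pow_one (lam hζ), lam_pow_dvd_iff] at h
  have h1 : (primePi hζ).valuation K ((c - 1 : localRing hζ) : K) < 1 :=
    h.trans_lt (WithZero.exp_lt_exp.2 (by norm_num))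
  have h2 := Valuation.map_one_add_of_lt _ h1
  rwa [show (1 : K) + ((c - 1 : localRing hζ) : K) = c by push_cast; ring] at h2

theorem isUnit_of_lam_dvd_sub_one (c : localRing hζ) (h : lam hζ ∣ c - 1) : IsUnit c := by
  have hc := valuation_eq_one_of_lam_dvd_sub_one c h
  have h0 : (c : K) ≠ 0 := fun h ↦ by simp [h] at hc
  refine IsUnit.of_mul_eq_one ⟨(c : K)⁻¹, ?_⟩ (Subtype.ext (mul_inv_cancel₀ h0))
  rw [mem_localRing, map_inv₀, hc, inv_one]

/-- The `σ`-eigenvector property of the class of `𝔟` lifts to `C`: up to a `p`-th power congruent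
to `1` modulo `π ^ p`, the automorphism `σ` acts on `C` as the power `μ`. -/
theorem IsAttached.exists_localRing (hp2 : p ≠ 2) (h : IsAttached hζ u σ 𝔟 μ m B C) :
    ∃ c : localRing hζ, (c : K) = C ∧ lam hζ ^ (2 * m + 1) ∣ c - 1 ∧
      lam hζ ^ p ∣ localMap hζ σ c - c ^ (μ : ZMod p).val := by
  have hC : C ∈ localRing hζ := h.congr_one.mem_localRing (one_mem _)
  lift C to localRing hζ using hC with c
  have hc : lam hζ ^ (2 * m + 1) ∣ c - 1 := (congrModPi_iff hζ _ c 1).1 h.congr_one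
  have hm := h.one_le
  have hc3 : lam hζ ^ 3 ∣ c - 1 := (pow_dvd_pow _ (by lia)).trans hc
  obtain ⟨a, k, hak⟩ := h.exists_map_eq hp2
  have hsl : lam hζ ∣ localMap hζ σ (lam hζ) := by
    obtain ⟨j, hj⟩ : ∃ j : ℕ, σ ζ = ζ ^ j :=
      ⟨_, IsCyclotomicExtension.Rat.galEquivZMod_apply_of_pow_eq p K σ hζ.pow_eq_one⟩
    have := (dvd_pow_self _ two_ne_zero).trans (lam_sq_dvd_localMap_lam_sub hζ hj)
    exact (dvd_iff_dvd_of_dvd_sub this).2 (dvd_mul_left _ _)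
  have hsc3 : lam hζ ^ 3 ∣ localMap hζ σ c - 1 := by
    have := map_dvd (localMap hζ σ) hc3
    rw [map_sub, map_one, map_pow] at this
    exact (pow_dvd_pow_of_dvd hsl 3).trans this
  -- All other factors in the formula for `σ C` have valuation `1`, hence so has `a`.
  have ha : a ∈ localRing hζ := by
    have h1 := valuation_eq_one_of_lam_dvd_sub_one _ ((dvd_pow_self _ three_ne_zero).trans hc3)
    have h2 := valuation_eq_one_of_lam_dvd_sub_one _ ((dvd_pow_self _ three_ne_zero).trans hsc3)
    have h3 := valuation_eq_one_of_lam_dvd_sub_one (1 + lam hζ) (by simp)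
    rw [show ((1 + lam hζ : localRing hζ) : K) = ζ by push_cast; rw [coe_lam]; ring] at h3
    rw [coe_localMap, hak, map_mul, map_mul, map_pow, map_pow, map_pow, h1, h3, one_pow, one_mul,
      one_pow, mul_one] at h2
    exact (pow_le_one_iff_of_nonneg zero_le hp.1.ne_zero).1 h2.le
  lift a to localRing hζ using ha
  refine ⟨c, rfl, hc, pow_dvd_sub_of_eq_mul (by have := h.le; lia) (lam_ne_zero hζ)
    (exists_int_lam_dvd_sub hζ) (lam_dvd_intCast_iff hζ) (lam_pow_dvd_prime hζ)
    (one_add_lam_pow hζ) hc3 hsc3 (a := a) (k := k) (Subtype.ext ?_)⟩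
  push_cast
  rw [coe_localMap, hak, coe_lam, add_sub_cancel]

/-- Powers of a primitive root modulo `p` determine the exponent in `[1, p - 1]` if one of the two
exponents is not `p - 1`; the exponent `0` is excluded, so `p - 1` is allowed on one side. -/
theorem eq_of_primitiveRoot_pow_eq (hu : IsPrimitiveRoot (u : ZMod p) (p - 1))
    {n k : ℕ} (hn : 1 ≤ n) (hnp : n < p) (hk : 1 ≤ k) (hkp : k < p - 1)
    (h : (u : ZMod p) ^ n = (u : ZMod p) ^ k) : n = k := by
  rcases (Nat.le_sub_one_of_lt hnp).eq_or_lt with rfl | hlt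
  · rw [hu.pow_eq_one] at h
    exact absurd (Nat.le_of_dvd hk (hu.dvd_of_pow_eq_one _ h.symm)) (by lia)
  · exact hu.pow_inj hlt hkp h

/-- The exponent `ν` of the leading term of a normalized `C - 1` is `2 * m + 1`. It is less than `p`
because `C` is not primary, and then the action of `σ` on the leading term forces
`u ^ ν = μ = u ^ (2 * m + 1)`. -/
theorem IsAttached.congr_one_add_lam_pow (hu : IsPrimitiveRoot (u : ZMod p) (p - 1))
    (hσ : σ ζ = ζ ^ u) (h : IsAttached hζ u σ 𝔟 μ m B C) (hC : IsSingularNotPrimary hζ C)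
    (hn : IsNormalized hζ C) {c : localRing hζ} (hcC : (c : K) = C)
    (hsc : lam hζ ^ p ∣ localMap hζ σ c - c ^ (μ : ZMod p).val) :
    lam hζ ^ (2 * m + 2) ∣ c - (1 + lam hζ ^ (2 * m + 1)) := by
  subst hcC
  obtain ⟨ν, hν, hcν⟩ := hn
  replace hcν : lam hζ ^ (ν + 1) ∣ c - (1 + lam hζ ^ ν) := by
    rw [← congrModPi_iff]
    push_cast
    exact hcν
  have hcν' : lam hζ ^ ν ∣ c - 1 := by
    convert dvd_add ((pow_dvd_pow _ (Nat.le_succ ν)).trans hcν) (dvd_refl (lam hζ ^ ν)) using 1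
    ring
  have hνp : ν < p := by
    by_contra! hle
    refine hC.2 ⟨hC.1, 1, ?_, ?_⟩
    · exact fun h1 ↦ hp.1.ne_one (by simpa using Int.eq_one_of_dvd_one (by positivity) h1)
    · have := (congrModPi_iff hζ p c 1).2 ((pow_dvd_pow _ hle).trans hcν')
      simpa using this
  have hpow : (u : ZMod p) ^ ν = (u : ZMod p) ^ (2 * m + 1) := by
    by_contra hne
    rw [← h.eigenvalue, ← ZMod.natCast_zmod_val (μ : ZMod p)] at hne
    have h1 := pow_succ_dvd_sub_one (lam_ne_zero hζ) (exists_int_lam_dvd_sub hζ)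
      (lam_dvd_intCast_iff hζ) (lam_sq_dvd_localMap_lam_sub hζ hσ) hν hne hcν'
      ((pow_dvd_pow _ hνp).trans hsc)
    have h2 : lam hζ ^ ν * lam hζ ∣ lam hζ ^ ν * ((1 : ℤ) : localRing hζ) := by
      rw [← pow_succ]
      convert dvd_sub h1 hcν using 1
      push_cast
      ring
    rw [mul_dvd_mul_iff_left (pow_ne_zero ν (lam_ne_zero hζ)), lam_dvd_intCast_iff] at h2
    exact hp.1.ne_one (by simpa using Int.eq_one_of_dvd_one (by positivity) h2)
  have hle := h.le
  obtain rfl := eq_of_primitiveRoot_pow_eq hu hν hνp (by lia) (by lia) hpow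
  exact hcν

omit [IsCyclotomicExtension {p} ℚ K] hp in
theorem IsSingular.mul_inv {C₁ C₂ : K} (h₁ : IsSingular p C₁)
    (h₂ : IsSingular p C₂) : IsSingular p (C₁ * C₂⁻¹) := by
  obtain ⟨h₁, c₁, hc₁⟩ := h₁
  obtain ⟨h₂, c₂, hc₂⟩ := h₂
  refine ⟨mul_ne_zero h₁ (inv_ne_zero h₂), c₁ * c₂⁻¹, ?_⟩
  rw [mul_pow, inv_pow, ← hc₁, ← hc₂, FractionalIdeal.spanSingleton_inv,
    FractionalIdeal.spanSingleton_mul_spanSingleton]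

end Main

end CyclotomicClass

open CyclotomicClass in
theorem theoreml203031 {p : ℕ} [Fact p.Prime] (hp2 : p ≠ 2)
    {K : Type*} [Field K] [NumberField K] [IsCyclotomicExtension {p} ℚ K]
    {ζ : K} (hζ : IsPrimitiveRoot ζ p)
    (u : ℕ) (hu : IsPrimitiveRoot (u : ZMod p) (p - 1))
    (σ : K ≃ₐ[ℚ] K) (hσ : σ ζ = ζ ^ u)
    (𝔟₁ 𝔟₂ : (Ideal (𝓞 K))⁰) (μ₁ μ₂ : (ZMod p)ˣ) (m₁ m₂ : ℕ) (B₁ B₂ : 𝓞 K) (C₁ C₂ : K)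
    (h₁ : CyclotomicClass.IsAttached hζ u σ 𝔟₁ μ₁ m₁ B₁ C₁)
    (h₂ : CyclotomicClass.IsAttached hζ u σ 𝔟₂ μ₂ m₂ B₂ C₂)
    (hC₁ : CyclotomicClass.IsSingularNotPrimary hζ C₁)
    (hC₂ : CyclotomicClass.IsSingularNotPrimary hζ C₂)
    (hn₁ : CyclotomicClass.IsNormalized hζ C₁)
    (hn₂ : CyclotomicClass.IsNormalized hζ C₂)
    (hμ : μ₁ = μ₂) :
    CyclotomicClass.IsSingularPrimary hζ (C₁ * C₂⁻¹) ∧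
      CyclotomicClass.CongrModPi hζ p C₁ C₂ := by
  subst hμ
  have hp : p.Prime := Fact.out
  have hle₁ := h₁.le
  have hle₂ := h₂.le
  obtain rfl : m₁ = m₂ := by
    have := eq_of_primitiveRoot_pow_eq hu (n := 2 * m₁ + 1) (k := 2 * m₂ + 1) (by lia) (by lia)
      (by lia) (by lia) (h₁.eigenvalue.symm.trans h₂.eigenvalue)
    lia
  obtain ⟨c₁, rfl, hc₁, hs₁⟩ := h₁.exists_localRing hp2
  obtain ⟨c₂, rfl, hc₂, hs₂⟩ := h₂.exists_localRing hp2
  have hl₁ := h₁.congr_one_add_lam_pow hu hσ hC₁ hn₁ rfl hs₁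
  have hl₂ := h₂.congr_one_add_lam_pow hu hσ hC₂ hn₂ rfl hs₂
  set e := (μ₁ : ZMod p).val with he
  set s := localMap hζ σ
  set l := lam hζ
  obtain ⟨i, hi⟩ := (isUnit_of_lam_dvd_sub_one c₂
    ((dvd_pow_self l (Nat.succ_ne_zero _)).trans hc₂)).exists_right_inv
  have hiK : (i : K) = (c₂ : K)⁻¹ := eq_inv_of_mul_eq_one_right (congrArg Subtype.val hi)
  have hsi : s c₂ * s i = 1 := by rw [← map_mul, hi, map_one]
  have hie : c₂ ^ e * i ^ e = 1 := by rw [← mul_pow, hi, one_pow]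
  have hd : l ^ p ∣ s (c₁ * i) - (c₁ * i) ^ e := by
    convert dvd_sub (hs₁.mul_right (s i)) (hs₂.mul_right (c₁ ^ e * s i * i ^ e)) using 1
    rw [map_mul, mul_pow]
    linear_combination c₁ ^ e * i ^ e * hsi - c₁ ^ e * s i * hie
  -- The congruence `c₁ / c₂ ≡ 1` holds modulo `π ^ (2 * m₁ + 2)` as the leading terms agree, and
  -- it improves by one step at each `n < p`, because `u ^ n ≠ u ^ (2 * m₁ + 1) = μ₁`.
  have hind : ∀ n, 2 * m₁ + 2 ≤ n → n ≤ p → l ^ n ∣ c₁ * i - 1 := by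
    intro n hn
    induction n, hn using Nat.le_induction with
    | base =>
      intro _
      convert (dvd_sub hl₁ hl₂).mul_right i using 1
      linear_combination hi
    | succ n hn ih =>
      intro hnp
      refine pow_succ_dvd_sub_one (lam_ne_zero hζ) (exists_int_lam_dvd_sub hζ)
        (lam_dvd_intCast_iff hζ) (lam_sq_dvd_localMap_lam_sub hζ hσ) (by lia) (m := e) ?_
        (ih (by lia)) ((pow_dvd_pow _ hnp).trans hd)
      rw [he, ZMod.natCast_zmod_val, h₁.eigenvalue]
      intro h
      have := eq_of_primitiveRoot_pow_eq hu (by lia) hnp (by lia) (by lia) h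
      lia
  have hfin := hind p (by lia) le_rfl
  refine ⟨⟨hC₁.1.mul_inv hC₂.1, 1, ?_, ?_⟩, ?_⟩
  · exact fun h ↦ hp.ne_one (by simpa using Int.eq_one_of_dvd_one (by positivity) h)
  · simpa [hiK] using (congrModPi_iff hζ p (c₁ * i) 1).2 hfin
  · rw [congrModPi_iff]
    convert hfin.mul_right c₂ using 1
    linear_combination -c₁ * hi
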